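/- **Standard push is not differentially private.** Consider the following rumor spreading protocol (parameterized gossip with muting parameter $s\in[0,1]$) on the complete graph with nodes $0,\dots,n-1$ and source $k$. Start with the sets of informed nodes $I=\{k\}$ and of active nodes $A=\{k\}$. While $|I|<n$: draw a sender $i$ uniformly at random from $A$; remove $i$ from $A$ with probability $1-s$; draw a receiver $j$ uniformly at random from $\{0,\dots,n-1\}$; $i$ sends the rumor to $j$, and $j$ is added to $I$ and to $A$ (all draws are independent given the past). Let $\mathcal C\subseteq\{0,\dots,n-1\}$ be a set of $f$ curious nodes. The output observed by the adversary is the ordered sequence of all messages $(i,j)$ with $j\in\mathcal C$, without their positions in the sequence of all messages. Write $p_k(S)$ for the probability that the output lies in the set $S$ when $k$ is the source. For real $\epsilon,\delta$, the protocol is called $(\epsilon,\delta)$-differentially private with respect to $\mathcal C$ if $p_i(S)\le e^{\epsilon}p_j(S)+\delta$ for all nodes $i,j\in\{0,\dots,n-1\}$ and all sets $S$ of outputs. Theorem. Let $0<\rho\le 1$ be rational, let $\epsilon\in\mathbb R$ and let $\delta\le 1$ be real. For each $n\ge 1$ for which $\rho n$ is an integer let $\mathcal C_n\subseteq\{0,\dots,n-1\}$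 be a set of $f=\rho n$ curious nodes. If, with the same $\epsilon$ and $\delta$ for all these $n$, standard push (the protocol with $s=1$) on $n$ nodes is $(\epsilon,\delta)$-differentially private with respect to $\mathcal C_n$, then $\delta=1$. -/

import Mathlib

open scoped ENNReal unitInterval

noncomputable section

namespace Gossip

/-- A state of a gossip protocol on the complete graph with nodes `0, …, n - 1`: the informed
nodes `I`, the (nonempty) set of active nodes `A`, and the ordered list of all messages
`(sender, receiver)` sent so far, i.e. the calls to the primitive `tell_gossip`. -/
structure State (n : ℕ) where
  informed : Finset (Fin n)
  active : Finset (Fin n)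
  active_nonempty : active.Nonempty
  messages : List (Fin n × Fin n)

/-- The initial state when `k` is the source: only `k` is informed and active. -/
def State.init {n : ℕ} (k : Fin n) : State n where
  informed := {k}
  active := {k}
  active_nonempty := Finset.singleton_nonempty k
  messages := []

/-- The state after the active node `i` sent the rumor to the node `j`, where `i` has been
removed from the active nodes beforehand unless `stay` is true. -/
def State.tell {n : ℕ} (x : State n) (i : Fin n) (stay : Bool) (j : Fin n) : State n where
  informed := insert j x.informed
  active := insert j (if stay then x.active else x.active.erase i)
  active_nonempty := Finset.insert_nonempty _ _
  messages := x.messages ++ [(i, j)]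

/-- The loop condition `|I| < n` fails: all nodes are informed. -/
def State.Terminated {n : ℕ} (x : State n) : Prop := ¬ x.informed.card < n

/-- A coin that shows `true` with probability `s` and `false` with probability `1 - s`. -/
def coin (s : I) : PMF Bool :=
  PMF.ofFintype (fun b => ENNReal.ofReal (if b then (s : ℝ) else 1 - s)) (by
    have h0 := s.2.1
    have h1 := s.2.2
    rw [Fintype.sum_bool, ← ENNReal.ofReal_add] <;> simp [h0, h1])

open Classical in
/-- One pass of the loop of parameterized gossip with muting parameter `s` (a terminated state
does not change any more): a sender `i` is drawn uniformly from the active nodes, it stays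
active with probability `s`, and a receiver `j` is drawn uniformly from all nodes. -/
def step {n : ℕ} [NeZero n] (s : I) (x : State n) : PMF (State n) :=
  if x.Terminated then PMF.pure x
  else
    (PMF.uniformOfFinset x.active x.active_nonempty).bind fun i =>
    (coin s).bind fun stay =>
    (PMF.uniformOfFintype (Fin n)).bind fun j =>
    PMF.pure (x.tell i stay j)

/-- The law of the state after (at most) `t` passes of the loop, started from the source `k`. -/
def stateLaw {n : ℕ} [NeZero n] (s : I) (k : Fin n) : ℕ → PMF (State n)
  | 0 => PMF.pure (State.init k)
  | t + 1 => (stateLaw s k t).bind (step s)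

/-- What the adversary observes: the ordered subsequence of all messages sent to a curious
node (a node in `C`), without their positions in the complete sequence. -/
def observed {n : ℕ} (C : Finset (Fin n)) (l : List (Fin n × Fin n)) : List (Fin n × Fin n) :=
  l.filter fun m => m.2 ∈ C

/-- `p_k(S)`: the probability that parameterized gossip with muting parameter `s` and source `k`
terminates with an observed output that belongs to `S`. The events "terminated after at most `t`
passes with output in `S`" increase with `t`; this is the supremum of their probabilities. -/
def outputProb {n : ℕ} [NeZero n] (s : I) (C : Finset (Fin n)) (k : Fin n)
    (S : Set (List (Fin n × Fin n))) : ℝ≥0∞ :=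
  ⨆ t : ℕ, (stateLaw s k t).toOuterMeasure {x | x.Terminated ∧ observed C x.messages ∈ S}

/-- `(ε, δ)`-differential privacy of parameterized gossip with muting parameter `s` with respect
to the set `C` of curious nodes: `p_i(S) ≤ e^ε p_j(S) + δ` for all nodes `i`, `j` and all sets `S`
of outputs. -/
def IsDifferentiallyPrivate {n : ℕ} [NeZero n] (s : I) (C : Finset (Fin n)) (ε δ : ℝ) : Prop :=
  ∀ (i j : Fin n) (S : Set (List (Fin n × Fin n))),
    (outputProb s C i S).toReal ≤ Real.exp ε * (outputProb s C j S).toReal + δ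

end Gossip

end

open Filter Topology

/-! The distinguishing event for a node `k` is that `k` sends one of the first `T` observed
messages. In standard push a source `k` never leaves the active set, and after `u` passes at most `u
+ 1` nodes are active, so pass `u` makes `k` send to a curious node with probability at least `ρ /
(u + 1)`. Hence the event has probability at least `1 - P_T` with `P_T = ∏_{u < T} (1 - ρ / (u +
1))` (`one_sub_prod_le_outputProb`).

For any fixed source, at most `T` nodes can be early senders, so these probabilities sum to at most
`T` over `k` (`sum_outputProb_earlySender_le`). Averaging the privacy inequality over `k` gives `1 -
P_T ≤ e^ε T / n + δ`. Letting `n → ∞` and then `T → ∞` yields `δ ≥ 1`, since `P_T → 0` by divergence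
of the harmonic series. -/

theorem one_sub_mul_one_div_succ_nonneg {r : ℝ} (h0 : 0 ≤ r) (h1 : r ≤ 1) (u : ℕ) :
    0 ≤ 1 - r * (1 / ((u : ℝ) + 1)) := by
  have h2 : (1 : ℝ) / (u + 1) ≤ 1 := by
    rw [div_le_one (by positivity)]
    linarith [(Nat.cast_nonneg u : (0 : ℝ) ≤ u)]
  nlinarith [show (0 : ℝ) ≤ 1 / (u + 1 : ℝ) by positivity]

/-! ### Probabilities of events under discrete laws and kernels -/

namespace PMF

variable {α β : Type*}

theorem toOuterMeasure_add_compl (p : PMF α) (B : Set α) :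
    p.toOuterMeasure B + p.toOuterMeasure Bᶜ = 1 := by
  rw [toOuterMeasure_apply, toOuterMeasure_apply, ← ENNReal.tsum_add, ← p.tsum_coe]
  exact tsum_congr fun x => Set.indicator_self_add_compl_apply B p x

theorem toOuterMeasure_le_one (p : PMF α) (B : Set α) : p.toOuterMeasure B ≤ 1 :=
  p.toOuterMeasure_add_compl B ▸ le_self_add

theorem toOuterMeasure_le_of_le_compl (p : PMF α) (B : Set α) {q : ℝ} (hq : 0 ≤ q)
    (h : ENNReal.ofReal q ≤ p.toOuterMeasure Bᶜ) :
    p.toOuterMeasure B ≤ ENNReal.ofReal (1 - q) := by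
  rw [ENNReal.ofReal_sub _ hq, ENNReal.ofReal_one]
  refine ENNReal.le_sub_of_add_le_right ENNReal.ofReal_ne_top ?_
  rw [← p.toOuterMeasure_add_compl B]
  gcongr

theorem mul_le_toOuterMeasure_bind (p : PMF α) (f : α → PMF β) (B : Set β) (a : α) :
    p a * (f a).toOuterMeasure B ≤ (p.bind f).toOuterMeasure B := by
  rw [toOuterMeasure_bind_apply]
  exact ENNReal.le_tsum a

theorem le_toOuterMeasure_bind (p : PMF α) (f : α → PMF β) (B : Set β) {c : ℝ≥0∞}
    (h : ∀ a, c ≤ (f a).toOuterMeasure B) : c ≤ (p.bind f).toOuterMeasure B := by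
  rw [toOuterMeasure_bind_apply]
  calc c = ∑' a, p a * c := by rw [ENNReal.tsum_mul_right, p.tsum_coe, one_mul]
    _ ≤ _ := ENNReal.tsum_le_tsum fun a => by gcongr; exact h a

/-- A kernel that never enters `B` from outside and stays in `B` with probability at most `c`
multiplies the probability of `B` by at most `c`. -/
theorem toOuterMeasure_bind_le_mul (p : PMF α) (f : α → PMF α) (B : Set α) (c : ℝ≥0∞)
    (hin : ∀ x ∈ p.support, x ∈ B → (f x).toOuterMeasure B ≤ c)
    (hout : ∀ x ∈ p.support, x ∉ B → (f x).toOuterMeasure B = 0) :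
    (p.bind f).toOuterMeasure B ≤ c * p.toOuterMeasure B := by
  rw [toOuterMeasure_bind_apply, toOuterMeasure_apply, ← ENNReal.tsum_mul_left]
  refine ENNReal.tsum_le_tsum fun x => ?_
  by_cases hx : x ∈ p.support
  · by_cases hB : x ∈ B
    · rw [Set.indicator_of_mem hB, mul_comm]
      gcongr
      exact hin x hx hB
    · simp [hout x hx hB]
  · simp [(p.apply_eq_zero_iff x).2 hx]

theorem toOuterMeasure_le_bind (p : PMF α) (f : α → PMF α) (B : Set α)
    (h : ∀ x ∈ B, f x = pure x) : p.toOuterMeasure B ≤ (p.bind f).toOuterMeasure B := by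
  rw [toOuterMeasure_bind_apply, toOuterMeasure_apply]
  refine ENNReal.tsum_le_tsum fun x => ?_
  by_cases hB : x ∈ B
  · rw [Set.indicator_of_mem hB, h x hB, (toOuterMeasure_pure_apply x B).trans (if_pos hB),
      mul_one]
  · simp [hB]

/-- The expected number of events that occur is at most any pointwise bound on that number. -/
theorem sum_toOuterMeasure_le {ι : Type*} (p : PMF α) (s : Finset ι) (B : ι → Set α) (m : ℕ)
    (h : ∀ x (t : Finset ι), t ⊆ s → (∀ i ∈ t, x ∈ B i) → t.card ≤ m) :
    ∑ i ∈ s, p.toOuterMeasure (B i) ≤ m := by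
  classical
  simp only [toOuterMeasure_apply]
  rw [← Summable.tsum_finsetSum fun _ _ => ENNReal.summable]
  calc ∑' x, ∑ i ∈ s, (B i).indicator p x ≤ ∑' x, (m : ℝ≥0∞) * p x := by
        refine ENNReal.tsum_le_tsum fun x => ?_
        simp only [Set.indicator_apply]
        rw [← Finset.sum_filter, Finset.sum_const, nsmul_eq_mul]
        gcongr
        exact h x _ (Finset.filter_subset _ _) fun i hi => (Finset.mem_filter.1 hi).2
    _ = m := by rw [ENNReal.tsum_mul_left, p.tsum_coe, mul_one]

end PMF

/-! ### Dynamics and termination of standard push -/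

namespace Gossip

variable {n : ℕ}

/-- The outputs in which `k` is a sender of one of the first `T` messages. -/
def earlySender (T : ℕ) (k : Fin n) : Set (List (Fin n × Fin n)) :=
  {l | k ∈ (l.take T).map Prod.fst}

theorem observed_tell (C : Finset (Fin n)) (x : State n) (i j : Fin n) :
    observed C (x.tell i true j).messages =
      observed C x.messages ++ if j ∈ C then [(i, j)] else [] := by
  by_cases h : j ∈ C <;> simp [observed, State.tell, List.filter_append, h]

theorem earlySender_append {T : ℕ} {k : Fin n} {l : List (Fin n × Fin n)}
    (h : l ∈ earlySender T k) (l' : List (Fin n × Fin n)) : l ++ l' ∈ earlySender T k :=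
  List.Sublist.subset (((List.prefix_append l l').take T).sublist.map _) h

variable [NeZero n]

theorem coin_one : coin 1 = PMF.pure true := by
  ext b
  cases b <;> simp [coin]

theorem step_of_terminated (s : unitInterval) {x : State n} (hx : x.Terminated) :
    step s x = PMF.pure x := if_pos hx

theorem step_one_of_not_terminated {x : State n} (hx : ¬ x.Terminated) :
    step 1 x = (PMF.uniformOfFinset x.active x.active_nonempty).bind fun i =>
      (PMF.uniformOfFintype (Fin n)).bind fun j => PMF.pure (x.tell i true j) := by
  rw [step, if_neg hx]
  simp only [coin_one, PMF.pure_bind]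

/-- Every state that one pass of standard push reaches is the old one or comes from a message. -/
theorem eq_or_eq_tell_of_mem_support_step {x y : State n} (hy : y ∈ (step 1 x).support) :
    y = x ∨ ∃ i j, y = x.tell i true j := by
  by_cases hx : x.Terminated
  · rw [step_of_terminated 1 hx] at hy
    exact .inl (by simpa using hy)
  · rw [step_one_of_not_terminated hx] at hy
    simp only [PMF.mem_support_bind_iff, PMF.mem_support_pure_iff] at hy
    obtain ⟨i, -, j, -, rfl⟩ := hy
    exact .inr ⟨i, j, rfl⟩

theorem step_eq_zero_of_notMem {x : State n} {B : Set (State n)} (hx : x ∉ B)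
    (h : ∀ i j, x.tell i true j ∉ B) : (step 1 x).toOuterMeasure B = 0 := by
  rw [PMF.toOuterMeasure_apply_eq_zero_iff, Set.disjoint_left]
  intro y hy
  obtain rfl | ⟨i, j, rfl⟩ := eq_or_eq_tell_of_mem_support_step hy
  exacts [hx, h i j]

theorem stateLaw_invariant (k : Fin n) (t : ℕ) {x : State n}
    (hx : x ∈ (stateLaw 1 k t).support) :
    k ∈ x.active ∧ x.active.card ≤ t + 1 ∧ x.informed.card ≤ t + 1 ∧ x.messages.length ≤ t := by
  induction t generalizing x with
  | zero =>
    obtain rfl : x = State.init k := by simpa [stateLaw] using hx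
    simp [State.init]
  | succ t ih =>
    obtain ⟨y, hy, hxy⟩ := (PMF.mem_support_bind_iff _ _ _).1 hx
    obtain ⟨h1, h2, h3, h4⟩ := ih hy
    obtain rfl | ⟨i, j, rfl⟩ := eq_or_eq_tell_of_mem_support_step hxy
    · exact ⟨h1, by omega, by omega, by omega⟩
    · refine ⟨by simp [State.tell, h1], ?_, ?_, by simp [State.tell, h4]⟩
      · exact (Finset.card_insert_le _ _).trans (by simpa using h2)
      · exact (Finset.card_insert_le _ _).trans (by simpa using h3)

/-- The probability that a node is still uninformed decays geometrically. -/
theorem stateLaw_not_informed_le (k v : Fin n) (t : ℕ) :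
    (stateLaw 1 k t).toOuterMeasure {x | v ∉ x.informed} ≤
      ENNReal.ofReal (1 - 1 / n) ^ t := by
  induction t with
  | zero => simpa using PMF.toOuterMeasure_le_one _ _
  | succ t ih =>
    rw [pow_succ']
    refine (PMF.toOuterMeasure_bind_le_mul _ _ _ (ENNReal.ofReal (1 - 1 / n)) ?_ ?_).trans
      (by gcongr)
    · intro x _ hv
      have hT : ¬ x.Terminated := by
        rw [State.Terminated, not_not]
        simpa using Finset.card_lt_univ_of_notMem hv
      rw [step_one_of_not_terminated hT]
      refine PMF.toOuterMeasure_le_of_le_compl _ _ (by positivity) ?_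
      -- Whoever the sender is, the receiver is `v` with probability `1 / n`.
      refine PMF.le_toOuterMeasure_bind _ _ _ fun i => ?_
      refine le_trans ?_ (PMF.mul_le_toOuterMeasure_bind _ _ _ v)
      rw [(PMF.toOuterMeasure_pure_apply _ _).trans (if_pos (by simp [State.tell]))]
      simp [ENNReal.ofReal_inv_of_pos, NeZero.pos n]
    · intro x _ hv
      refine step_eq_zero_of_notMem hv fun i j => ?_
      have hv' : v ∈ x.informed := by simpa using hv
      simp [State.tell, hv']

theorem stateLaw_not_terminated_le (k : Fin n) (t : ℕ) :
    (stateLaw 1 k t).toOuterMeasure {x | ¬ x.Terminated} ≤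
      n * ENNReal.ofReal (1 - 1 / n) ^ t := by
  have hsub : {x : State n | ¬ x.Terminated} ⊆ ⋃ v, {x | v ∉ x.informed} := by
    intro x hx
    by_contra h
    have hall : x.informed = Finset.univ := by
      ext v
      simpa using fun hv => h (Set.mem_iUnion.2 ⟨v, hv⟩)
    exact hx (by simp [State.Terminated, hall])
  calc _ ≤ (stateLaw 1 k t).toOuterMeasure (⋃ v, {x | v ∉ x.informed}) :=
        MeasureTheory.measure_mono hsub
    _ ≤ ∑ v, (stateLaw 1 k t).toOuterMeasure {x | v ∉ x.informed} :=
        MeasureTheory.measure_iUnion_fintype_le _ _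
    _ ≤ ∑ _v : Fin n, ENNReal.ofReal (1 - 1 / n) ^ t :=
        Finset.sum_le_sum fun v _ => stateLaw_not_informed_le k v t
    _ = _ := by simp

/-! ### A source is likely to be an early sender -/

/-- Each pass contributes one factor: the source is drawn with probability at least `1 / (u + 1)`,
and independently the receiver is curious with probability `|C| / n`. Since `T < n`, all `T` passes
take place before termination. -/
theorem stateLaw_source_not_sender_le (C : Finset (Fin n)) (k : Fin n) (T : ℕ) (hT : T < n) :
    (stateLaw 1 k T).toOuterMeasure {x | k ∉ (observed C x.messages).map Prod.fst} ≤
      ENNReal.ofReal (∏ u ∈ Finset.range T, (1 - (C.card : ℝ) / n * (1 / (u + 1)))) := by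
  have hn : (0 : ℝ) < n := by exact_mod_cast NeZero.pos n
  have hC : (C.card : ℝ) / n ≤ 1 := by
    rw [div_le_one hn]
    exact_mod_cast (Finset.card_le_univ C).trans_eq (Fintype.card_fin n)
  induction T with
  | zero => simpa using PMF.toOuterMeasure_le_one _ _
  | succ T ih =>
    have hfac : 0 ≤ 1 - (C.card : ℝ) / n * (1 / (T + 1)) :=
      one_sub_mul_one_div_succ_nonneg (by positivity) hC T
    rw [Finset.prod_range_succ, mul_comm, ENNReal.ofReal_mul hfac]
    refine (PMF.toOuterMeasure_bind_le_mul _ _ _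
      (ENNReal.ofReal (1 - (C.card : ℝ) / n * (1 / (T + 1)))) ?_ ?_).trans
      (mul_le_mul_right (ih (by omega)) _)
    · intro x hx _
      obtain ⟨hk, hA, hI, -⟩ := stateLaw_invariant k T hx
      have hT : ¬ x.Terminated := by
        rw [State.Terminated, not_not]
        omega
      rw [step_one_of_not_terminated hT]
      refine PMF.toOuterMeasure_le_of_le_compl _ _ (by positivity) ?_
      refine le_trans ?_ (PMF.mul_le_toOuterMeasure_bind _ _ _ k)
      rw [PMF.uniformOfFinset_apply_of_mem _ hk, mul_comm ((C.card : ℝ) / n),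
        ENNReal.ofReal_mul (by positivity)]
      gcongr
      · rw [one_div, ENNReal.ofReal_inv_of_pos (by positivity)]
        gcongr
        rw [← Nat.cast_succ, ENNReal.ofReal_natCast]
        exact_mod_cast hA
      · change _ ≤ (PMF.map (x.tell k true) (PMF.uniformOfFintype (Fin n))).toOuterMeasure _
        rw [PMF.toOuterMeasure_map_apply]
        have hsub : (C : Set (Fin n)) ⊆ x.tell k true ⁻¹'
            {x | k ∉ (observed C x.messages).map Prod.fst}ᶜ := by
          intro j hj
          have hj' : j ∈ C := hj
          simpa [observed_tell, hj'] using ⟨j, fun _ => rfl⟩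
        refine le_trans ?_ (MeasureTheory.measure_mono hsub)
        rw [PMF.toOuterMeasure_apply_finset, ENNReal.ofReal_div_of_pos hn]
        simp [div_eq_mul_inv]
    · intro x _ hk
      refine step_eq_zero_of_notMem hk fun i j => ?_
      simp only [Set.mem_ofPred_eq, not_not] at hk ⊢
      rw [observed_tell, List.map_append]
      exact List.mem_append_left _ hk

/-- At time `T` at most `T` messages have been observed, so truncation to the first `T` has no
effect; later messages are appended and cannot undo the event. -/
theorem stateLaw_not_earlySender_le (C : Finset (Fin n)) (k : Fin n) {T : ℕ} (hT : T < n)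
    {t : ℕ} (ht : T ≤ t) :
    (stateLaw 1 k t).toOuterMeasure {x | observed C x.messages ∉ earlySender T k} ≤
      ENNReal.ofReal (∏ u ∈ Finset.range T, (1 - (C.card : ℝ) / n * (1 / (u + 1)))) := by
  induction t, ht using Nat.le_induction with
  | base =>
    refine le_trans (PMF.toOuterMeasure_mono _ ?_) (stateLaw_source_not_sender_le C k T hT)
    rintro x ⟨hx, hs⟩
    have hlen : (observed C x.messages).length ≤ T :=
      (List.length_filter_le _ _).trans (stateLaw_invariant k T hs).2.2.2
    simpa only [earlySender, Set.mem_ofPred_eq, List.take_of_length_le hlen] using hx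
  | succ t _ ih =>
    refine le_trans ?_ ih
    conv_rhs => rw [← one_mul ((stateLaw 1 k t).toOuterMeasure _)]
    refine PMF.toOuterMeasure_bind_le_mul _ _ _ 1 (fun x _ _ => PMF.toOuterMeasure_le_one _ _) ?_
    intro x _ hx
    refine step_eq_zero_of_notMem hx fun i j => ?_
    simp only [Set.mem_ofPred_eq, not_not] at hx ⊢
    rw [observed_tell]
    exact earlySender_append hx _

theorem outputProb_le_one (s : unitInterval) (C : Finset (Fin n)) (k : Fin n)
    (S : Set (List (Fin n × Fin n))) : outputProb s C k S ≤ 1 :=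
  iSup_le fun _ => PMF.toOuterMeasure_le_one _ _

theorem one_sub_prod_le_outputProb (C : Finset (Fin n)) (k : Fin n) {T : ℕ} (hT : T < n) :
    1 - ∏ u ∈ Finset.range T, (1 - (C.card : ℝ) / n * (1 / (u + 1))) ≤
      (outputProb 1 C k (earlySender T k)).toReal := by
  have hn : (1 : ℝ) ≤ n := by exact_mod_cast NeZero.pos n
  set P := ∏ u ∈ Finset.range T, (1 - (C.card : ℝ) / n * (1 / (u + 1)))
  have hP : 0 ≤ P := by
    refine Finset.prod_nonneg fun u _ => ?_
    have h1 : (C.card : ℝ) / n ≤ 1 := by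
      rw [div_le_one (by linarith)]
      exact_mod_cast (Finset.card_le_univ C).trans_eq (Fintype.card_fin n)
    exact one_sub_mul_one_div_succ_nonneg (by positivity) h1 u
  have hr0 : (0 : ℝ) ≤ 1 - 1 / n := by
    rw [sub_nonneg, div_le_one (by linarith)]
    exact hn
  have hr1 : (1 : ℝ) - 1 / n < 1 := sub_lt_self _ (by positivity)
  -- The term `n * (1 - 1 / n) ^ t` pays for runs not terminated by time `t`; it vanishes as `t →
  -- ∞`.
  have hlim : Tendsto (fun t : ℕ => 1 - P - n * (1 - 1 / n : ℝ) ^ t) atTop (𝓝 (1 - P)) := by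
    simpa using ((tendsto_pow_atTop_nhds_zero_of_lt_one hr0 hr1).const_mul (n : ℝ)).const_sub
      (1 - P)
  refine le_of_tendsto hlim ((eventually_ge_atTop T).mono fun t ht => ?_)
  set G : Set (State n) := {x | x.Terminated ∧ observed C x.messages ∈ earlySender T k}
  have hGc : Gᶜ ⊆ {x | ¬ x.Terminated} ∪ {x | observed C x.messages ∉ earlySender T k} :=
    fun x hx => not_and_or.1 hx
  have h1 : (1 : ℝ≥0∞) ≤ outputProb 1 C k (earlySender T k) +
      ENNReal.ofReal (n * (1 - 1 / n : ℝ) ^ t + P) := by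
    rw [← (stateLaw 1 k t).toOuterMeasure_add_compl G]
    refine add_le_add (le_iSup
      (fun t => (stateLaw 1 k t).toOuterMeasure {x | x.Terminated ∧
        observed C x.messages ∈ earlySender T k}) t) ?_
    refine (MeasureTheory.measure_mono hGc).trans ((MeasureTheory.measure_union_le _ _).trans ?_)
    rw [ENNReal.ofReal_add (by positivity) hP, ENNReal.ofReal_mul (by positivity),
      ENNReal.ofReal_pow hr0, ENNReal.ofReal_natCast]
    exact add_le_add (stateLaw_not_terminated_le k t) (stateLaw_not_earlySender_le C k hT ht)
  have hfin : outputProb 1 C k (earlySender T k) ≠ ⊤ :=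
    ne_top_of_le_ne_top ENNReal.one_ne_top (outputProb_le_one _ _ _ _)
  have h2 := ENNReal.toReal_mono (ENNReal.add_ne_top.2 ⟨hfin, ENNReal.ofReal_ne_top⟩) h1
  rw [ENNReal.toReal_add hfin ENNReal.ofReal_ne_top,
    ENNReal.toReal_ofReal (by positivity), ENNReal.toReal_one] at h2
  linarith

/-! ### Averaging over the candidate nodes -/

theorem sum_outputProb_earlySender_le (C : Finset (Fin n)) (j : Fin n) (T : ℕ) :
    ∑ k, (outputProb 1 C j (earlySender T k)).toReal ≤ T := by
  have hmono (S : Set (List (Fin n × Fin n))) : Monotone fun t =>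
      (stateLaw 1 j t).toOuterMeasure {x | x.Terminated ∧ observed C x.messages ∈ S} :=
    monotone_nat_of_le_succ fun t =>
      PMF.toOuterMeasure_le_bind _ _ _ fun x hx => step_of_terminated 1 hx.1
  rw [← ENNReal.toReal_sum fun k _ =>
    ne_top_of_le_ne_top ENNReal.one_ne_top (outputProb_le_one _ _ _ _)]
  refine ENNReal.toReal_le_of_le_ofReal (by positivity) ?_
  rw [ENNReal.ofReal_natCast]
  simp only [outputProb]
  -- Terminated states are frozen, so the events increase with `t` and the supremum commutes with
  -- the sum; at each fixed `t`, `T` messages have at most `T` distinct senders.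
  rw [ENNReal.finsetSum_iSup_of_monotone fun k => hmono _]
  refine iSup_le fun t => PMF.sum_toOuterMeasure_le _ _ _ T fun x s _ hs => ?_
  calc s.card ≤ (((observed C x.messages).take T).map Prod.fst).toFinset.card :=
        Finset.card_le_card fun k hk => List.mem_toFinset.2 (hs k hk).2
    _ ≤ (((observed C x.messages).take T).map Prod.fst).length := List.toFinset_card_le _
    _ ≤ T := by simp

/-- Privacy is applied to every source `k` against the reference source `0`, with a set of outputs
that depends on `k`. -/
theorem IsDifferentiallyPrivate.one_sub_prod_le {C : Finset (Fin n)} {ε δ : ℝ}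
    (h : IsDifferentiallyPrivate 1 C ε δ) {T : ℕ} (hT : T < n) :
    1 - ∏ u ∈ Finset.range T, (1 - (C.card : ℝ) / n * (1 / (u + 1))) ≤
      Real.exp ε * T / n + δ := by
  have hn : (0 : ℝ) < n := by exact_mod_cast NeZero.pos n
  set P := ∏ u ∈ Finset.range T, (1 - (C.card : ℝ) / n * (1 / (u + 1)))
  have hk (k : Fin n) : 1 - P ≤
      Real.exp ε * (outputProb 1 C 0 (earlySender T k)).toReal + δ :=
    (one_sub_prod_le_outputProb C k hT).trans (h k 0 _)
  have hsum := Finset.sum_le_sum fun k (_ : k ∈ Finset.univ) => hk k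
  rw [Finset.sum_add_distrib, ← Finset.mul_sum] at hsum
  simp only [Finset.sum_const, Finset.card_univ, Fintype.card_fin, nsmul_eq_mul] at hsum
  have hT' := mul_le_mul_of_nonneg_left (sum_outputProb_earlySender_le C 0 T) (Real.exp_nonneg ε)
  have : n * (1 - P) ≤ n * (Real.exp ε * T / n + δ) := by
    rw [mul_add, mul_div_cancel₀ _ hn.ne']
    linarith
  exact le_of_mul_le_mul_left this hn

end Gossip

/-! ### Limits in `T` and `n` -/

theorem tendsto_prod_one_sub_div_succ {r : ℝ} (h0 : 0 < r) (h1 : r ≤ 1) :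
    Tendsto (fun T => ∏ u ∈ Finset.range T, (1 - r * (1 / ((u : ℝ) + 1)))) atTop (𝓝 0) := by
  have hfac := one_sub_mul_one_div_succ_nonneg h0.le h1
  have hexp : Tendsto (fun T => Real.exp (-(r * ∑ u ∈ Finset.range T, 1 / ((u : ℝ) + 1)))) atTop
      (𝓝 0) :=
    Real.tendsto_exp_neg_atTop_nhds_zero.comp
      (Real.tendsto_sum_range_one_div_nat_succ_atTop.const_mul_atTop h0)
  refine squeeze_zero (fun T => Finset.prod_nonneg fun u _ => hfac u) (fun T => ?_) hexp
  rw [Finset.mul_sum, ← Finset.sum_neg_distrib, Real.exp_sum]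
  exact Finset.prod_le_prod (fun u _ => hfac u) fun u _ => Real.one_sub_le_exp_neg _

theorem mainTheorem1 (ρ : ℚ) (hρ_pos : 0 < ρ) (hρ_le : ρ ≤ 1)
    (C : (n : ℕ) → Finset (Fin n))
    (hC : ∀ n f : ℕ, (f : ℚ) = ρ * n → (C n).card = f)
    (ε δ : ℝ) (hδ : δ ≤ 1)
    (hDP : ∀ (n : ℕ) [NeZero n] (f : ℕ), (f : ℚ) = ρ * n →
      Gossip.IsDifferentiallyPrivate (1 : unitInterval) (C n) ε δ) :
    δ = 1 := by
  refine le_antisymm hδ ?_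
  have hT (T : ℕ) : 1 - ∏ u ∈ Finset.range T, (1 - (ρ : ℝ) * (1 / ((u : ℝ) + 1))) ≤ δ := by
    -- With `T` fixed, `n` runs through the multiples `ρ.den * m`, for which `ρ n = ρ.num * m` is an
    -- integer.
    have hlim : Tendsto (fun m : ℕ => Real.exp ε * T / ((ρ.den * m : ℕ) : ℝ) + δ) atTop
        (𝓝 (0 + δ)) :=
      ((tendsto_natCast_atTop_atTop.comp
        (tendsto_id.const_mul_atTop' ρ.den_pos)).const_div_atTop _).add_const δ
    rw [zero_add] at hlim
    refine ge_of_tendsto hlim ((eventually_gt_atTop T).mono fun m hm => ?_)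
    have hTn : T < ρ.den * m := hm.trans_le (Nat.le_mul_of_pos_left m ρ.den_pos)
    have : NeZero (ρ.den * m) := ⟨by omega⟩
    have hf : ((ρ.num.toNat * m : ℕ) : ℚ) = ρ * (ρ.den * m : ℕ) := by
      have hnum : ((ρ.num.toNat : ℕ) : ℚ) = ρ.num := by
        exact_mod_cast Int.toNat_of_nonneg (Rat.num_pos.2 hρ_pos).le
      push_cast
      rw [hnum, ← mul_assoc, Rat.mul_den_eq_num]
    have hcard : ((C (ρ.den * m)).card : ℝ) / (ρ.den * m : ℕ) = ρ := by
      rw [hC _ _ hf, div_eq_iff (by exact_mod_cast NeZero.ne (ρ.den * m))]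
      exact_mod_cast hf
    simpa only [hcard] using (hDP _ _ hf).one_sub_prod_le hTn
  have hρ0 : (0 : ℝ) < ρ := by exact_mod_cast hρ_pos
  have hρ1 : (ρ : ℝ) ≤ 1 := by exact_mod_cast hρ_le
  have hlim := (tendsto_prod_one_sub_div_succ hρ0 hρ1).const_sub 1
  rw [sub_zero] at hlim
  exact le_of_tendsto' hlim hT
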